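/- A \emph{directed column-convex polyomino} (dccp) is a finite set $P$ of unit cells of the square lattice, taken up to translation, such that every cell of $P$ can be reached from the bottom left-hand corner cell of $P$ (the origin) by a path of north and east steps inside $P$, and such that the cells of $P$ in each column are consecutive. Its \emph{area} is its number of cells. The \emph{initial altitude} $a_i$ of its $i$-th column (counted from the left) is the height of the lowest cell of that column. For an integer $d\ge 0$, a dccp with $k$ columns is \emph{$d$-restricted} if $k\le 2$ or $a_{i+1}-a_i\ge d$ for all $2\le i\le k-1$. The \emph{internal path length} of a cell $c$ of $P$ is the minimum number of cells, both ends counted, on a path from the origin to $c$ that moves inside $P$ between cells sharing a side (so the origin has internal path length $1$). The \emph{total internal path length} of $P$ is the sum of the internal path lengths of its cells. \textbf{Theorem.} For $d\ge 0$ and $n\ge 0$, let $t_d(n)$ be the sum of the total internal path lengths of all $d$-restricted dccp of area $n$. Then, as formal power series, $$\sum_{n\ge 0} t_d(n)x^n=\frac{f_d(x)}{g_d(x)},$$ where $g_d(x)=2\left((x-1)^3-(x-1)x^{d+1}\right)^3$ (which has non-zero constant term) and \begin{align*} f_d(x)={}&-(d^2+7d+18)x^{d+3}+2(2d^2+10d+13)x^{d+4}-2(3d^2+9d+11)x^{d+5}\\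 &+4(d^2+d+2)x^{d+6}-(d^2-3d-10)x^{2d+4}+(2d^2-4d-6)x^{2d+5}+6x^{d+2}\\ &-(d-1)d\,x^{d+7}-6x^{2d+3}-(d-1)d\,x^{2d+6}+2x^{3d+4}\\ &-6x^7+22x^6-30x^5+20x^4-10x^3+6x^2-2x. \end{align*} -/

import Mathlib

open Polynomial

namespace Dccp

/-- A cell of the square lattice, named by its column (first coordinate) and its altitude
(second coordinate). -/
abbrev Cell := ℤ × ℤ

/-- A north or an east step that stays inside `P`. -/
def NEStep (P : Finset Cell) (a b : Cell) : Prop :=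
  a ∈ P ∧ b ∈ P ∧ (b = (a.1 + 1, a.2) ∨ b = (a.1, a.2 + 1))

/-- `P` is directed: every cell of `P` is joined to the bottom left-hand corner cell by a path
inside `P` made of north and east steps. Polyominoes are taken up to translation, and the
representative used has its corner cell at `(0, 0)`. The empty polyomino is allowed. -/
def IsDirected (P : Finset Cell) : Prop :=
  (P.Nonempty → ((0, 0) : Cell) ∈ P) ∧
    ∀ c ∈ P, Relation.ReflTransGen (NEStep P) (0, 0) c

/-- `P` is column-convex: the cells of a column between two cells of `P` belong to `P`. -/
def IsColumnConvex (P : Finset Cell) : Prop :=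
  ∀ i y₁ y y₂ : ℤ, (i, y₁) ∈ P → (i, y₂) ∈ P → y₁ ≤ y → y ≤ y₂ → (i, y) ∈ P

/-- Directed column-convex polyominoes, with their bottom left-hand corner cell at the origin. -/
def IsDccp (P : Finset Cell) : Prop := IsDirected P ∧ IsColumnConvex P

/-- `a` is the initial altitude of column `i` of `P`: the altitude of its lowest cell.
This holds for no `a` when `P` has no cell in column `i`. -/
def IsInitialAltitude (P : Finset Cell) (i a : ℤ) : Prop :=
  IsLeast {y : ℤ | (i, y) ∈ P} a

/-- `P` has at most two columns, or the initial altitude grows by at least `d` from each column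
other than the first one (which is column `0`) to the next column. -/
def IsRestricted (d : ℕ) (P : Finset Cell) : Prop :=
  (P.image Prod.fst).card ≤ 2 ∨
    ∀ i a b : ℤ, 1 ≤ i → IsInitialAltitude P i a → IsInitialAltitude P (i + 1) b →
      (d : ℤ) ≤ b - a

/-- The graph whose edges join the cells of `P` that share a side. -/
def cellGraph (P : Finset Cell) : SimpleGraph Cell :=
  SimpleGraph.fromRel (NEStep P)

/-- The internal path length of a cell `c`: the least number of cells on a path in `P` from the
origin cell to `c`, both ends counted (so the origin has internal path length `1`). -/
noncomputable def ipl (P : Finset Cell) (c : Cell) : ℕ :=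
  (cellGraph P).dist (0, 0) c + 1

/-- The total internal path length. -/
noncomputable def tipl (P : Finset Cell) : ℕ := ∑ c ∈ P, ipl P c

/-- The `d`-restricted directed column-convex polyominoes of area `n`. -/
def restrictedDccp (d n : ℕ) : Set (Finset Cell) :=
  {P | IsDccp P ∧ IsRestricted d P ∧ P.card = n}

theorem exists_subset_of_reachable (P : Finset Cell) (h0 : ((0, 0) : Cell) ∈ P) (c : Cell)
    (h : Relation.ReflTransGen (NEStep P) (0, 0) c) :
    0 ≤ c.1 ∧ 0 ≤ c.2 ∧ ∃ Q ⊆ P, (Q.card : ℤ) = c.1 + c.2 + 1 ∧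
      ∀ q ∈ Q, q.1 + q.2 ≤ c.1 + c.2 := by
  induction h with
  | refl => exact ⟨le_rfl, le_rfl, {(0, 0)}, by simpa using h0, by simp, by simp⟩
  | @tail b c _ hbc ih =>
    obtain ⟨h1, h2, Q, hQ, hcard, hle⟩ := ih
    obtain ⟨_, hc, hs⟩ := hbc
    have hsum : c.1 + c.2 = b.1 + b.2 + 1 := by
      rcases hs with rfl | rfl <;> simp <;> ring
    have hnot : c ∉ Q := fun hcQ => by have := hle c hcQ; omega
    refine ⟨?_, ?_, insert c Q, Finset.insert_subset hc hQ, ?_, ?_⟩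
    · rcases hs with rfl | rfl <;> simp <;> omega
    · rcases hs with rfl | rfl <;> simp <;> omega
    · rw [Finset.card_insert_of_notMem hnot]; push_cast; omega
    · intro q hq
      rcases Finset.mem_insert.1 hq with rfl | hq
      · exact le_rfl
      · have := hle q hq; omega

theorem restrictedDccp_finite (d n : ℕ) : (restrictedDccp d n).Finite := by
  refine Set.Finite.subset
    (Finset.finite_toSet ((Finset.Icc (0 : ℤ) n ×ˢ Finset.Icc (0 : ℤ) n).powerset)) ?_
  rintro P ⟨⟨⟨h0, hdir⟩, _⟩, _, hn⟩
  rw [Finset.mem_coe, Finset.mem_powerset]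
  intro c hc
  obtain ⟨h1, h2, Q, hQ, hcard, _⟩ := exists_subset_of_reachable P (h0 ⟨c, hc⟩) c (hdir c hc)
  have := Finset.card_le_card hQ
  simp only [Finset.mem_product, Finset.mem_Icc]
  omega

/-- `t d n` is the sum of the total internal path lengths of all `d`-restricted directed
column-convex polyominoes of area `n`. -/
noncomputable def t (d n : ℕ) : ℕ :=
  ∑ P ∈ (restrictedDccp_finite d n).toFinset, tipl P

/-- The numerator. -/
noncomputable def f (d : ℕ) : ℚ[X] :=
  -C ((d : ℚ) ^ 2 + 7 * d + 18) * X ^ (d + 3)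
    + 2 * C (2 * (d : ℚ) ^ 2 + 10 * d + 13) * X ^ (d + 4)
    - 2 * C (3 * (d : ℚ) ^ 2 + 9 * d + 11) * X ^ (d + 5)
    + 4 * C ((d : ℚ) ^ 2 + d + 2) * X ^ (d + 6)
    - C ((d : ℚ) ^ 2 - 3 * d - 10) * X ^ (2 * d + 4)
    + C (2 * (d : ℚ) ^ 2 - 4 * d - 6) * X ^ (2 * d + 5)
    + 6 * X ^ (d + 2)
    - C (((d : ℚ) - 1) * d) * X ^ (d + 7)
    - 6 * X ^ (2 * d + 3)
    - C (((d : ℚ) - 1) * d) * X ^ (2 * d + 6)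
    + 2 * X ^ (3 * d + 4)
    - 6 * X ^ 7 + 22 * X ^ 6 - 30 * X ^ 5 + 20 * X ^ 4 - 10 * X ^ 3 + 6 * X ^ 2 - 2 * X

/-- The denominator. -/
noncomputable def g (d : ℕ) : ℚ[X] :=
  2 * ((X - 1) ^ 3 - (X - 1) * X ^ (d + 1)) ^ 3

end Dccp

namespace Dccp

/-! The sum of coordinates changes by one along each edge and a north-east path attains this bound,
so cell `(i, y)` has internal path length `i + y + 1` (`ipl_eq`). Total path length is therefore a
sum of coordinates, and behaves additively when the first column is removed.

A nonempty dccp is a single column, or a column of height `h` followed by a nonempty dccp `Q` raised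
by some `s < h`, in exactly one way (`eq_column_or_glue`, `glue_inj`). The total is then `h(h+1)/2 +
tipl Q + (1+s)|Q|` (`tipl_glue`). Bounding the first altitude step by `e` and the later ones by `d`
makes this recursive: the class `(e, d)` reduces to `(d, d)`, and `d`-restriction is the class `(0,
d)`.

Let `B`, `T` be the area and path length series of the class `(d, d)`, and `K = (1-x)^2 - x^(d+1)`.
The recursion gives `K B = x(1-x)`; the weight `|Q|` contributes `x B'`. The equation for totals at
`e = d` determines `T`, and at `e = 0` it then yields the required series, over `g = -2(1-x)^3 K^3`.
-/

/-! ### Directedness and internal path length -/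

theorem IsDirected.nonneg {P : Finset Cell} (h : IsDirected P) {c : Cell} (hc : c ∈ P) :
    0 ≤ c.1 ∧ 0 ≤ c.2 := by
  obtain ⟨h1, h2, -⟩ := exists_subset_of_reachable P (h.1 ⟨c, hc⟩) c (h.2 c hc)
  exact ⟨h1, h2⟩

theorem IsDirected.west_or_south {P : Finset Cell} (h : IsDirected P) {c : Cell} (hc : c ∈ P) :
    c = (0, 0) ∨ (c.1 - 1, c.2) ∈ P ∨ (c.1, c.2 - 1) ∈ P := by
  rcases Relation.ReflTransGen.cases_tail (h.2 c hc) with h0 | ⟨b, -, hb, -, rfl | rfl⟩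
  · exact Or.inl h0
  · right; left; simpa using hb
  · right; right; simpa using hb

/-- A local test for directedness: passing to a west or south neighbour lowers the nonnegative sum
of coordinates, so the descent ends at the origin. -/
theorem isDirected_of_west_or_south {P : Finset Cell} (h0 : P.Nonempty → ((0, 0) : Cell) ∈ P)
    (hP : ∀ c ∈ P, 0 ≤ c.1 ∧ 0 ≤ c.2 ∧
      (c = (0, 0) ∨ (c.1 - 1, c.2) ∈ P ∨ (c.1, c.2 - 1) ∈ P)) : IsDirected P := by
  refine ⟨h0, ?_⟩
  have key : ∀ n : ℕ, ∀ c ∈ P, c.1 + c.2 = n → Relation.ReflTransGen (NEStep P) (0, 0) c := by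
    intro n
    induction n with
    | zero =>
      intro c hc hn
      obtain ⟨h1, h2, -⟩ := hP c hc
      have : c = (0, 0) := Prod.ext (by simp at hn ⊢; omega) (by simp at hn ⊢; omega)
      rw [this]
    | succ n ih =>
      intro c hc hn
      obtain ⟨-, -, rfl | h | h⟩ := hP c hc
      · exact Relation.ReflTransGen.refl
      · exact (ih _ h (by push_cast at hn ⊢; omega)).tail ⟨h, hc, Or.inl (by simp)⟩
      · exact (ih _ h (by push_cast at hn ⊢; omega)).tail ⟨h, hc, Or.inr (by simp)⟩
  intro c hc
  obtain ⟨h1, h2, -⟩ := hP c hc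
  exact key (c.1 + c.2).toNat c hc (by omega)

/-- Induction on the cells of a directed polyomino along the anti-diagonals. -/
theorem IsDirected.induction {P : Finset Cell} (h : IsDirected P) {p : Cell → Prop}
    (step : ∀ c ∈ P, (∀ b ∈ P, b.1 + b.2 < c.1 + c.2 → p b) → p c) : ∀ c ∈ P, p c := by
  have key : ∀ n : ℕ, ∀ c ∈ P, c.1 + c.2 < n → p c := by
    intro n
    induction n with
    | zero => intro c hc hn; have := h.nonneg hc; push_cast at hn; omega
    | succ n ih =>
      intro c hc hn
      exact step c hc fun b hb hbc => ih b hb (by push_cast at hn; omega)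
  intro c hc
  have := h.nonneg hc
  exact key ((c.1 + c.2).toNat + 1) c hc (by omega)

theorem sub_le_walk_length {P : Finset Cell} {a b : Cell} (w : (cellGraph P).Walk a b) :
    b.1 + b.2 - (a.1 + a.2) ≤ w.length := by
  induction w with
  | nil => simp
  | cons hadj w ih =>
    rw [cellGraph, SimpleGraph.fromRel_adj] at hadj
    rw [SimpleGraph.Walk.length_cons]
    push_cast
    rcases hadj with ⟨-, ⟨-, -, rfl | rfl⟩ | ⟨-, -, rfl | rfl⟩⟩ <;> simp at ih ⊢ <;> omega

theorem exists_walk_of_reachable {P : Finset Cell} {c : Cell}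
    (h : Relation.ReflTransGen (NEStep P) (0, 0) c) :
    ∃ w : (cellGraph P).Walk (0, 0) c, (w.length : ℤ) = c.1 + c.2 := by
  induction h with
  | refl => exact ⟨SimpleGraph.Walk.nil, by simp⟩
  | @tail b c _ hbc ih =>
    obtain ⟨w, hw⟩ := ih
    have hadj : (cellGraph P).Adj b c := by
      rw [cellGraph, SimpleGraph.fromRel_adj]
      refine ⟨?_, Or.inl hbc⟩
      rintro rfl
      obtain ⟨-, -, h | h⟩ := hbc <;> simp [Prod.ext_iff] at h
    refine ⟨w.concat hadj, ?_⟩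
    rw [SimpleGraph.Walk.length_concat]
    push_cast
    rw [hw]
    obtain ⟨-, -, rfl | rfl⟩ := hbc <;> simp <;> ring

theorem ipl_eq {P : Finset Cell} (h : IsDirected P) {c : Cell} (hc : c ∈ P) :
    (ipl P c : ℤ) = c.1 + c.2 + 1 := by
  obtain ⟨w, hw⟩ := exists_walk_of_reachable (h.2 c hc)
  obtain ⟨v, hv⟩ := w.reachable.exists_walk_length_eq_dist
  have h1 := SimpleGraph.dist_le w
  have h2 := sub_le_walk_length v
  simp at h2
  rw [ipl]
  push_cast
  omega

theorem tipl_eq {P : Finset Cell} (h : IsDirected P) :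
    (tipl P : ℤ) = ∑ c ∈ P, (c.1 + c.2 + 1) := by
  rw [tipl]
  push_cast
  exact Finset.sum_congr rfl fun c hc => ipl_eq h hc

/-! ### Columns and gluing -/

/-- The polyomino with a single column, of height `h`. -/
noncomputable def column (h : ℕ) : Finset Cell := ({0} : Finset ℤ) ×ˢ Finset.Ico 0 (h : ℤ)

/-- The polyomino `Q`, moved one column to the right and `s` cells up, with a column of height `h`
placed to its left. -/
noncomputable def glue (h s : ℕ) (Q : Finset Cell) : Finset Cell :=
  column h ∪ Q.map (Equiv.addRight ((1, (s : ℤ)) : Cell)).toEmbedding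

theorem mem_column {h : ℕ} {i y : ℤ} : (i, y) ∈ column h ↔ i = 0 ∧ 0 ≤ y ∧ y < h := by
  simp [column, and_comm, eq_comm]

theorem mem_glue {h s : ℕ} {Q : Finset Cell} {i y : ℤ} :
    (i, y) ∈ glue h s Q ↔ (i = 0 ∧ 0 ≤ y ∧ y < h) ∨ (i - 1, y - s) ∈ Q := by
  rw [glue, Finset.mem_union, mem_column]
  refine or_congr Iff.rfl ?_
  simp only [Finset.mem_map, Equiv.coe_toEmbedding, Equiv.coe_addRight]
  constructor
  · rintro ⟨⟨a, b⟩, hq, h⟩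
    simp only [Prod.mk_add_mk, Prod.mk.injEq] at h
    obtain ⟨rfl, rfl⟩ := h
    simpa using hq
  · intro hq
    exact ⟨_, hq, by simp⟩

theorem isDccp_column {h : ℕ} (hh : 0 < h) : IsDccp (column h) := by
  refine ⟨isDirected_of_west_or_south (fun _ => mem_column.2 ⟨rfl, le_rfl, by omega⟩) ?_, ?_⟩
  · rintro ⟨i, y⟩ hc
    obtain ⟨rfl, h1, h2⟩ := mem_column.1 hc
    refine ⟨le_rfl, h1, ?_⟩
    simp only [mem_column, Prod.mk.injEq, true_and]
    omega
  · intro i y₁ y y₂ h1 h2 h3 h4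
    rw [mem_column] at *
    omega

theorem IsDirected.mk_nonneg {P : Finset Cell} (h : IsDirected P) {i y : ℤ} (hc : (i, y) ∈ P) :
    0 ≤ i ∧ 0 ≤ y := h.nonneg hc

/-- The condition `s < h` puts the raised corner of `Q` beside a cell of the new column; every other
cell of `Q` keeps its predecessor. -/
theorem isDccp_glue {h s : ℕ} {Q : Finset Cell} (hs : s < h) (hQ : IsDccp Q) :
    IsDccp (glue h s Q) := by
  obtain ⟨hdir, hconv⟩ := hQ
  refine ⟨isDirected_of_west_or_south
    (fun _ => mem_glue.2 (Or.inl ⟨rfl, le_rfl, by omega⟩)) ?_, ?_⟩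
  · rintro ⟨i, y⟩ hc
    rcases mem_glue.1 hc with ⟨rfl, h1, h2⟩ | hc
    · refine ⟨le_rfl, h1, ?_⟩
      simp only [mem_glue, Prod.mk.injEq, true_and]
      rcases h1.eq_or_lt with h1 | h1
      · exact Or.inl h1.symm
      · exact Or.inr (Or.inr (Or.inl ⟨by omega, by omega⟩))
    · have h1 := hdir.mk_nonneg hc
      refine ⟨by simp; omega, by simp; omega, Or.inr ?_⟩
      simp only [mem_glue]
      rcases hdir.west_or_south hc with h0 | hw | hs'
      · simp only [Prod.mk.injEq] at h0
        exact Or.inl (Or.inl (by omega))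
      · exact Or.inl (Or.inr hw)
      · refine Or.inr (Or.inr ?_)
        rwa [sub_right_comm]
  · intro i y₁ y y₂ h1 h2 h3 h4
    rw [mem_glue] at *
    rcases h1 with h1 | h1
    · rcases h2 with h2 | h2
      · exact Or.inl (by omega)
      · have := hdir.mk_nonneg h2; omega
    · rcases h2 with h2 | h2
      · have := hdir.mk_nonneg h1; omega
      · exact Or.inr (hconv _ _ _ _ h1 h2 (by omega) (by omega))

theorem mem_glue_zero {h s : ℕ} {Q : Finset Cell} (hQ : IsDirected Q) {y : ℤ} :
    (0, y) ∈ glue h s Q ↔ 0 ≤ y ∧ y < h := by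
  rw [mem_glue]
  constructor
  · rintro (h1 | h1)
    · exact h1.2
    · have := hQ.mk_nonneg h1; omega
  · exact fun h => Or.inl ⟨rfl, h⟩

theorem mem_glue_of_pos {h s : ℕ} {Q : Finset Cell} {i y : ℤ} (hi : 1 ≤ i) :
    (i, y) ∈ glue h s Q ↔ (i - 1, y - s) ∈ Q := by
  rw [mem_glue]
  constructor
  · rintro (h1 | h1)
    · omega
    · exact h1
  · exact Or.inr

/-! ### Initial altitudes and restriction -/

theorem isInitialAltitude_zero_iff {P : Finset Cell} (hP : IsDirected P) (hne : P.Nonempty)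
    {a : ℤ} : IsInitialAltitude P 0 a ↔ a = 0 := by
  have h0 : IsInitialAltitude P 0 0 := ⟨hP.1 hne, fun y hy => (hP.mk_nonneg hy).2⟩
  exact ⟨fun ha => ha.unique h0, fun ha => ha ▸ h0⟩

theorem isInitialAltitude_glue {h s : ℕ} {Q : Finset Cell} {i a : ℤ} (hi : 1 ≤ i) :
    IsInitialAltitude (glue h s Q) i a ↔ IsInitialAltitude Q (i - 1) (a - s) := by
  constructor
  · rintro ⟨h1, h2⟩
    refine ⟨(mem_glue_of_pos hi).1 h1, fun y hy => ?_⟩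
    have := @h2 (y + s) ((mem_glue_of_pos hi).2 (by simpa using hy))
    omega
  · rintro ⟨h1, h2⟩
    refine ⟨(mem_glue_of_pos hi).2 h1, fun y hy => ?_⟩
    have := h2 ((mem_glue_of_pos hi).1 hy)
    omega

theorem isInitialAltitude_glue_one {h s : ℕ} {Q : Finset Cell} (hQ : IsDirected Q)
    (hne : Q.Nonempty) {a : ℤ} : IsInitialAltitude (glue h s Q) 1 a ↔ a = s := by
  rw [isInitialAltitude_glue le_rfl, sub_self, isInitialAltitude_zero_iff hQ hne, sub_eq_zero]

theorem glue_nonempty {h s : ℕ} {Q : Finset Cell} (hh : 0 < h) : (glue h s Q).Nonempty :=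
  ⟨(0, 0), mem_glue.2 (Or.inl ⟨rfl, le_rfl, by omega⟩)⟩

/-- The initial altitude grows by at least `e` from the first column to the second one, and by at
least `d` from every other column to the next one. -/
def AltitudeSteps (e d : ℕ) (P : Finset Cell) : Prop :=
  (∀ a b : ℤ, IsInitialAltitude P 0 a → IsInitialAltitude P 1 b → (e : ℤ) ≤ b - a) ∧
    ∀ i a b : ℤ, 1 ≤ i → IsInitialAltitude P i a → IsInitialAltitude P (i + 1) b →
      (d : ℤ) ≤ b - a

/-- The altitude of the second column is `s`, and column `i` of `Q` becomes column `i + 1`, so even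
the first step of `Q` falls under the bound `d`. -/
theorem altitudeSteps_glue {e d h s : ℕ} {Q : Finset Cell} (hs : s < h) (hQ : IsDccp Q)
    (hne : Q.Nonempty) : AltitudeSteps e d (glue h s Q) ↔ e ≤ s ∧ AltitudeSteps d d Q := by
  have hg := (isDccp_glue hs hQ).1
  have h1 : (∀ a b : ℤ, IsInitialAltitude (glue h s Q) 0 a → IsInitialAltitude (glue h s Q) 1 b →
      (e : ℤ) ≤ b - a) ↔ e ≤ s := by
    simp only [isInitialAltitude_zero_iff hg (glue_nonempty (by omega)),
      isInitialAltitude_glue_one hQ.1 hne]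
    constructor
    · intro h; simpa using h 0 s rfl rfl
    · rintro h a b rfl rfl; simpa using h
  rw [AltitudeSteps, h1]
  refine and_congr Iff.rfl ⟨fun H => ⟨fun a b ha hb => ?_, fun i a b hi ha hb => ?_⟩,
    fun H i a b hi ha hb => ?_⟩
  · have := H 1 (a + s) (b + s) le_rfl ((isInitialAltitude_glue le_rfl).2 (by simpa using ha))
      ((isInitialAltitude_glue (by norm_num)).2 (by simpa using hb))
    omega
  · have := H (i + 1) (a + s) (b + s) (by omega)
      ((isInitialAltitude_glue (by omega)).2 (by simpa using ha))
      ((isInitialAltitude_glue (by omega)).2 (by simpa using hb))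
    omega
  · have ha' := (isInitialAltitude_glue hi).1 ha
    have hb' := (isInitialAltitude_glue (by omega)).1 hb
    rw [show i + 1 - 1 = i by ring] at hb'
    rcases hi.eq_or_lt with rfl | hi
    · have := H.1 _ _ ha' hb'
      omega
    · have := H.2 (i - 1) _ _ (by omega) ha' (by simpa using hb')
      omega

theorem altitudeSteps_column {e d h : ℕ} : AltitudeSteps e d (column h) := by
  constructor
  · rintro a b - ⟨hb, -⟩
    have := (mem_column.1 hb).1
    omega
  · rintro i a b hi ⟨ha, -⟩
    have := (mem_column.1 ha).1
    omega

theorem IsDirected.exists_mem_column {P : Finset Cell} (h : IsDirected P) {i : ℤ} (hi : 0 ≤ i) :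
    ∀ c ∈ P, i ≤ c.1 → ∃ y, (i, y) ∈ P := by
  refine h.induction fun c hc ih hic => ?_
  rcases hic.eq_or_lt with rfl | hic
  · exact ⟨c.2, hc⟩
  rcases h.west_or_south hc with rfl | hw | hs
  · simp at hic; omega
  · exact ih _ hw (by simp) (by simp; omega)
  · exact ih _ hs (by simp) (by simp; omega)

theorem exists_isInitialAltitude {P : Finset Cell} (hP : IsDirected P) {i y : ℤ}
    (h : (i, y) ∈ P) : ∃ a, IsInitialAltitude P i a := by
  obtain ⟨a, ha, hmin⟩ := Int.exists_least_of_bdd (P := fun y => (i, y) ∈ P)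
    ⟨0, fun z hz => (hP.mk_nonneg hz).2⟩ ⟨y, h⟩
  exact ⟨a, ha, fun z hz => hmin z hz⟩

/-- The bound `0` on the first step is automatic. The alternative of at most two columns is
absorbed: a constrained pair `i, i + 1` with `1 ≤ i` forces three distinct columns `0, i, i + 1`. -/
theorem isRestricted_iff {d : ℕ} {P : Finset Cell} (hP : IsDirected P) :
    IsRestricted d P ↔ AltitudeSteps 0 d P := by
  constructor
  · intro H
    refine ⟨fun a b ha hb => ?_, ?_⟩
    · have h1 := (isInitialAltitude_zero_iff hP ⟨_, ha.1⟩).1 ha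
      have h2 := hP.mk_nonneg hb.1
      push_cast
      omega
    · rcases H with H | H
      · intro i a b hi ha hb
        exfalso
        obtain ⟨z, hz⟩ := hP.exists_mem_column le_rfl _ ha.1 (by simp; omega)
        have : ({0, i, i + 1} : Finset ℤ) ⊆ P.image Prod.fst := by
          intro j hj
          simp only [Finset.mem_insert, Finset.mem_singleton] at hj
          rw [Finset.mem_image]
          rcases hj with rfl | rfl | rfl
          exacts [⟨_, hz, rfl⟩, ⟨_, ha.1, rfl⟩, ⟨_, hb.1, rfl⟩]
        have hcard := Finset.card_le_card this
        rw [Finset.card_eq_three.2 ⟨0, i, i + 1, by omega, by omega, by omega, rfl⟩] at hcard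
        omega
      · exact H
  · exact fun H => Or.inr H.2

/-! ### Decomposition by the first column -/

theorem exists_height {P : Finset Cell} (hP : IsDccp P) (hne : P.Nonempty) :
    ∃ h : ℕ, 0 < h ∧ ∀ y : ℤ, (0, y) ∈ P ↔ 0 ≤ y ∧ y < h := by
  have h0 := hP.1.1 hne
  -- Altitudes are nonnegative, so their sum over `P` bounds each of them.
  obtain ⟨b, hb, hmax⟩ := Int.exists_greatest_of_bdd (P := fun y => ((0 : ℤ), y) ∈ P)
    ⟨∑ c ∈ P, c.2, fun z hz => Finset.single_le_sum (f := fun c : Cell => c.2)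
      (fun c hc => (hP.1.nonneg hc).2) hz⟩ ⟨0, h0⟩
  have hb0 := (hP.1.mk_nonneg hb).2
  refine ⟨b.toNat + 1, by omega, fun y => ⟨fun hy => ?_, fun hy => ?_⟩⟩
  · have := hmax y hy
    have := (hP.1.mk_nonneg hy).2
    push_cast
    omega
  · push_cast at hy
    exact hP.2 0 0 y b h0 hb hy.1 (by omega)

/-- A directed column-convex polyomino is a single column, or is obtained from a smaller one by
adding a first column. -/
theorem eq_column_or_glue {P : Finset Cell} (hP : IsDccp P) (hne : P.Nonempty) :
    (∃ h, 0 < h ∧ P = column h) ∨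
      ∃ h s Q, s < h ∧ IsDccp Q ∧ Q.Nonempty ∧ P = glue h s Q := by
  obtain ⟨h, hh, hcol⟩ := exists_height hP hne
  by_cases H : ∃ y, (1, y) ∈ P
  · right
    obtain ⟨y, hy⟩ := H
    obtain ⟨a, ha⟩ := exists_isInitialAltitude hP.1 hy
    -- The lowest cell of column `1` has no south neighbour, hence a west neighbour in column `0`.
    have ha0 : 0 ≤ a ∧ a < h := by
      rcases hP.1.west_or_south ha.1 with h1 | h1 | h1
      · simp at h1
      · exact (hcol a).1 (by simpa using h1)
      · have := ha.2 h1; simp at this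
    obtain ⟨s, rfl⟩ := Int.eq_ofNat_of_zero_le ha0.1
    -- No later column dips below `s`, so the remainder moved down by `s` stays at nonnegative
    -- altitude.
    have hmin : ∀ c ∈ P, 1 ≤ c.1 → (s : ℤ) ≤ c.2 := by
      refine hP.1.induction fun c hc ih h1 => ?_
      rcases h1.eq_or_lt with h1 | h1
      · exact ha.2 (show (1, c.2) ∈ P by rw [h1]; exact hc)
      rcases hP.1.west_or_south hc with rfl | hw | hs
      · simp at h1
      · have := ih _ hw (by simp) (by simp; omega)
        exact this
      · have := ih _ hs (by simp) (by simp; omega)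
        simp at this
        omega
    let Q : Finset Cell := (P.filter fun c => 1 ≤ c.1).map
      (Equiv.addRight ((-1, -(s : ℤ)) : Cell)).toEmbedding
    have hQ : ∀ i y : ℤ, (i, y) ∈ Q ↔ 0 ≤ i ∧ (i + 1, y + s) ∈ P := by
      intro i y
      simp only [Q, Finset.mem_map, Equiv.coe_toEmbedding, Equiv.coe_addRight, Finset.mem_filter]
      constructor
      · rintro ⟨⟨a, b⟩, ⟨hq, h1⟩, h2⟩
        simp only [Prod.mk_add_mk, Prod.mk.injEq] at h2
        obtain ⟨rfl, rfl⟩ := h2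
        simp at h1 ⊢
        exact ⟨h1, hq⟩
      · rintro ⟨hi, hq⟩
        exact ⟨_, ⟨hq, by simpa using hi⟩, by simp⟩
    have hQ0 : ((0, 0) : Cell) ∈ Q := (hQ 0 0).2 ⟨le_rfl, by simpa using ha.1⟩
    refine ⟨h, s, Q, by omega, ⟨isDirected_of_west_or_south (fun _ => hQ0) ?_, ?_⟩,
      ⟨_, hQ0⟩, ?_⟩
    · rintro ⟨i, y⟩ hc
      obtain ⟨hi, hc⟩ := (hQ i y).1 hc
      have h1 := hmin _ hc (by simpa using hi)
      simp at h1
      refine ⟨hi, h1, ?_⟩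
      simp only [hQ]
      by_cases hi0 : i = 0
      · subst hi0
        rcases h1.eq_or_lt with h1 | h1
        · exact Or.inl (by rw [← h1])
        -- Above the lowest cell of column `1`, convexity supplies the south neighbour; a west
        -- neighbour might lie in the removed column.
        · exact Or.inr (Or.inr ⟨le_rfl, hP.2 _ _ _ _ ha.1 hc (by omega) (by omega)⟩)
      · rcases hP.1.west_or_south hc with h2 | h2 | h2
        · simp only [Prod.mk.injEq] at h2; omega
        · refine Or.inr (Or.inl ⟨by omega, ?_⟩)
          rwa [sub_add_eq_add_sub]
        · refine Or.inr (Or.inr ⟨hi, ?_⟩)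
          rwa [sub_add_eq_add_sub]
    · intro i y₁ y y₂ h1 h2 h3 h4
      rw [hQ] at *
      exact ⟨h1.1, hP.2 _ _ _ _ h1.2 h2.2 (by omega) (by omega)⟩
    · ext ⟨i, y⟩
      rw [mem_glue, hQ]
      simp only [sub_add_cancel]
      constructor
      · intro hc
        have := hP.1.mk_nonneg hc
        by_cases hi : i = 0
        · subst hi
          exact Or.inl ⟨rfl, (hcol y).1 hc⟩
        · exact Or.inr ⟨by omega, hc⟩
      · rintro (⟨rfl, hc⟩ | ⟨-, hc⟩)
        · exact (hcol y).2 hc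
        · exact hc
  · left
    refine ⟨h, hh, ?_⟩
    ext ⟨i, y⟩
    rw [mem_column]
    constructor
    · intro hc
      have h1 := hP.1.mk_nonneg hc
      have hi : i = 0 := by
        by_contra hi
        exact H (hP.1.exists_mem_column zero_le_one _ hc (by simp; omega))
      subst hi
      exact ⟨rfl, (hcol y).1 hc⟩
    · rintro ⟨rfl, hc⟩
      exact (hcol y).2 hc

theorem height_eq_of_iff {h h' : ℕ} (H : ∀ y : ℤ, (0 ≤ y ∧ y < h) ↔ (0 ≤ y ∧ y < h')) :
    h = h' := by
  have h1 := H h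
  have h2 := H h'
  omega

/-- The height of column `0` recovers `h`, the initial altitude of column `1` recovers `s`, and
translation recovers `Q`. -/
theorem glue_inj {h s h' s' : ℕ} {Q Q' : Finset Cell} (hQ : IsDirected Q) (hne : Q.Nonempty)
    (hQ' : IsDirected Q') (hne' : Q'.Nonempty) (H : glue h s Q = glue h' s' Q') :
    h = h' ∧ s = s' ∧ Q = Q' := by
  have h1 : h = h' := height_eq_of_iff fun y => by
    rw [← mem_glue_zero hQ (s := s), H, mem_glue_zero hQ']
  have h2 : s = s' := by
    have := (isInitialAltitude_glue_one (h := h) (s := s) hQ hne).2 rfl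
    rw [H, isInitialAltitude_glue_one hQ' hne'] at this
    exact_mod_cast this
  refine ⟨h1, h2, ?_⟩
  subst h1 h2
  ext ⟨i, y⟩
  by_cases hi : 0 ≤ i
  · have key : ∀ R : Finset Cell, (i, y) ∈ R ↔ (i + 1, y + s) ∈ glue h s R := fun R => by
      rw [mem_glue_of_pos (by omega)]; simp
    rw [key, H, ← key]
  · exact iff_of_false (fun hc => hi (hQ.mk_nonneg hc).1) (fun hc => hi (hQ'.mk_nonneg hc).1)

theorem glue_ne_column {h s n : ℕ} {Q : Finset Cell} (hQ : IsDirected Q) (hne : Q.Nonempty) :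
    glue h s Q ≠ column n := by
  intro H
  have : ((1, s) : Cell) ∈ column n := by
    rw [← H, mem_glue_of_pos le_rfl]
    simpa using hQ.1 hne
  simpa using (mem_column.1 this).1

theorem disjoint_column_map {h s : ℕ} {Q : Finset Cell} (hQ : IsDirected Q) :
    Disjoint (column h) (Q.map (Equiv.addRight ((1, (s : ℤ)) : Cell)).toEmbedding) := by
  rw [Finset.disjoint_right]
  intro c hc
  rw [Finset.mem_map] at hc
  obtain ⟨q, hq, rfl⟩ := hc
  have := hQ.nonneg hq
  intro h0
  have := (mem_column.1 h0).1
  simp at this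
  omega

/-! ### Area and path length under gluing -/

theorem card_column (h : ℕ) : (column h).card = h := by simp [column]

theorem card_glue {h s : ℕ} {Q : Finset Cell} (hQ : IsDirected Q) :
    (glue h s Q).card = h + Q.card := by
  rw [glue, Finset.card_union_of_disjoint (disjoint_column_map hQ), card_column, Finset.card_map]

theorem sum_column (h : ℕ) : 2 * ∑ c ∈ column h, (c.1 + c.2 + 1) = (h : ℤ) * (h + 1) := by
  rw [column, Finset.sum_product, Finset.sum_singleton]
  induction h with
  | zero => simp
  | succ n ih =>
    rw [show ((n + 1 : ℕ) : ℤ) = (n : ℤ) + 1 by push_cast; rfl,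
      ← Order.succ_eq_add_one, Finset.Ico_succ_right_eq_Icc, ← Finset.Ico_insert_right (by omega),
      Finset.sum_insert (by simp), mul_add, ih]
    simp
    ring

theorem tipl_column {h : ℕ} (hh : 0 < h) : 2 * (tipl (column h) : ℤ) = h * (h + 1) := by
  rw [tipl_eq (isDccp_column hh).1, sum_column]

/-- Translation by `(1, s)` adds `1 + s` to the path length of each cell of `Q`. Doubling avoids
division in the column term. -/
theorem tipl_glue {h s : ℕ} {Q : Finset Cell} (hs : s < h) (hQ : IsDccp Q) :
    2 * (tipl (glue h s Q) : ℤ) = h * (h + 1) + 2 * tipl Q + 2 * (1 + s) * Q.card := by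
  rw [tipl_eq (isDccp_glue hs hQ).1, glue, Finset.sum_union (disjoint_column_map hQ.1), mul_add,
    sum_column, tipl_eq hQ.1, Finset.sum_map, add_assoc]
  congr 1
  rw [mul_assoc 2, ← mul_add, mul_comm (1 + (s : ℤ)), ← nsmul_eq_mul, ← Finset.sum_const,
    ← Finset.sum_add_distrib]
  congr 1
  refine Finset.sum_congr rfl fun c _ => ?_
  simp
  ring

/-! ### Recurrences in the area -/

theorem steppedDccp_finite (e d n : ℕ) :
    {P : Finset Cell | IsDccp P ∧ AltitudeSteps e d P ∧ P.card = n}.Finite := by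
  refine (restrictedDccp_finite 0 n).subset ?_
  rintro P ⟨hP, hs, hn⟩
  exact ⟨hP, Or.inr fun i a b hi ha hb => le_trans (by simp) (hs.2 i a b hi ha hb), hn⟩

/-- The directed column-convex polyominoes of area `n` whose initial altitude grows by at least `e`
from the first column to the second one, and by at least `d` from then on. -/
noncomputable def steppedDccp (e d n : ℕ) : Finset (Finset Cell) :=
  (steppedDccp_finite e d n).toFinset

theorem mem_steppedDccp {e d n : ℕ} {P : Finset Cell} :
    P ∈ steppedDccp e d n ↔ IsDccp P ∧ AltitudeSteps e d P ∧ P.card = n := by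
  simp [steppedDccp]

theorem t_eq_sum (d n : ℕ) : t d n = ∑ P ∈ steppedDccp 0 d n, tipl P := by
  rw [t]
  congr 1
  ext P
  rw [mem_steppedDccp, Set.Finite.mem_toFinset]
  exact and_congr_right fun hP => and_congr_left fun _ => isRestricted_iff hP.1

/-- The data of a first column, of its position and of the rest of a polyomino of area `n`. -/
noncomputable def gluingData (e d n : ℕ) : Finset ((_ : ℕ) × (_ : ℕ) × Finset Cell) :=
  (Finset.range n).sigma fun h => (Finset.Ico e h).sigma fun _ => steppedDccp d d (n - h)

theorem mem_gluingData {e d n h s : ℕ} {Q : Finset Cell} :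
    (⟨h, s, Q⟩ : (_ : ℕ) × (_ : ℕ) × Finset Cell) ∈ gluingData e d n ↔
      h < n ∧ (e ≤ s ∧ s < h) ∧ IsDccp Q ∧ AltitudeSteps d d Q ∧ Q.card = n - h := by
  simp [gluingData, mem_steppedDccp]

theorem steppedDccp_eq {e d n : ℕ} (hn : 0 < n) :
    steppedDccp e d n =
      insert (column n) ((gluingData e d n).image fun x => glue x.1 x.2.1 x.2.2) := by
  ext P
  rw [Finset.mem_insert, Finset.mem_image, mem_steppedDccp]
  constructor
  · rintro ⟨hP, hs, hc⟩
    rcases eq_column_or_glue hP (Finset.card_pos.1 (hc ▸ hn)) with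
      ⟨h, -, rfl⟩ | ⟨h, s, Q, hsh, hQ, hne, rfl⟩
    · rw [card_column] at hc
      exact Or.inl (by rw [hc])
    · right
      rw [card_glue hQ.1] at hc
      have := Finset.card_pos.2 hne
      obtain ⟨h1, h2⟩ := (altitudeSteps_glue hsh hQ hne).1 hs
      exact ⟨⟨h, s, Q⟩, mem_gluingData.2 ⟨by omega, ⟨h1, hsh⟩, hQ, h2, by omega⟩, rfl⟩
  · rintro (rfl | ⟨⟨h, s, Q⟩, hx, rfl⟩)
    · exact ⟨isDccp_column hn, altitudeSteps_column, card_column n⟩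
    · obtain ⟨h1, ⟨h2, h3⟩, hQ, h4, h5⟩ := mem_gluingData.1 hx
      have hne : Q.Nonempty := Finset.card_pos.1 (by omega)
      exact ⟨isDccp_glue h3 hQ, (altitudeSteps_glue h3 hQ hne).2 ⟨h2, h4⟩,
        by rw [card_glue hQ.1]; dsimp only; omega⟩

theorem sum_steppedDccp {e d n : ℕ} (hn : 0 < n) (φ : Finset Cell → ℚ) :
    ∑ P ∈ steppedDccp e d n, φ P = φ (column n) + ∑ h ∈ Finset.range n,
      ∑ s ∈ Finset.Ico e h, ∑ Q ∈ steppedDccp d d (n - h), φ (glue h s Q) := by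
  have hne : ∀ {h s Q}, (⟨h, s, Q⟩ : (_ : ℕ) × (_ : ℕ) × Finset Cell) ∈ gluingData e d n →
      IsDirected Q ∧ Q.Nonempty := fun hx => by
    obtain ⟨h1, -, hQ, -, h5⟩ := mem_gluingData.1 hx
    exact ⟨hQ.1, Finset.card_pos.1 (by omega)⟩
  rw [steppedDccp_eq hn, Finset.sum_insert, Finset.sum_image]
  · simp only [gluingData, Finset.sum_sigma]
  · rintro ⟨h, s, Q⟩ hx ⟨h', s', Q'⟩ hx' H
    obtain ⟨rfl, rfl, rfl⟩ := glue_inj (hne hx).1 (hne hx).2 (hne hx').1 (hne hx').2 H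
    rfl
  · rw [Finset.mem_image]
    rintro ⟨⟨h, s, Q⟩, hx, H⟩
    exact glue_ne_column (hne hx).1 (hne hx).2 H

/-- The number of nonempty polyominoes in `steppedDccp e d n`. -/
noncomputable def count (e d n : ℕ) : ℚ := if n = 0 then 0 else (steppedDccp e d n).card

/-- The sum of the total internal path lengths over `steppedDccp e d n`. -/
noncomputable def total (e d n : ℕ) : ℚ := ∑ P ∈ steppedDccp e d n, (tipl P : ℚ)

theorem total_zero (e d : ℕ) : total e d 0 = 0 := by
  refine Finset.sum_eq_zero fun P hP => ?_
  have := Finset.card_eq_zero.1 (mem_steppedDccp.1 hP).2.2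
  simp [this, tipl]

/-- The truncated difference `h - e` counts the shifts `e ≤ s < h`, and vanishes when there are
none. -/
theorem count_eq {e d n : ℕ} (hn : 0 < n) :
    count e d n = 1 + ∑ h ∈ Finset.range n, ((h - e : ℕ) : ℚ) * count d d (n - h) := by
  have h := sum_steppedDccp (e := e) (d := d) hn fun _ => 1
  simp only [Finset.sum_const, nsmul_eq_mul, mul_one, Nat.card_Ico] at h
  rw [count, if_neg hn.ne', h]
  congr 1
  refine Finset.sum_congr rfl fun h hh => ?_
  rw [count, if_neg (by have := Finset.mem_range.1 hh; omega)]

theorem total_eq {e d n : ℕ} (hn : 0 < n) :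
    2 * total e d n = n * (n + 1) + ∑ h ∈ Finset.range n,
      (((h - e : ℕ) : ℚ) * (h * (h + 1)) * count d d (n - h)
        + 2 * (((h - e : ℕ) : ℚ) * total d d (n - h))
        + 2 * ((∑ s ∈ Finset.Ico e h, (1 + s : ℚ)) * (((n - h : ℕ) : ℚ) * count d d (n - h)))) := by
  rw [total, sum_steppedDccp hn, mul_add]
  have hcol : 2 * (tipl (column n) : ℚ) = n * (n + 1) := by exact_mod_cast tipl_column hn
  rw [hcol]
  congr 1
  rw [Finset.mul_sum]
  refine Finset.sum_congr rfl fun h hh => ?_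
  have hnh : n - h ≠ 0 := by have := Finset.mem_range.1 hh; omega
  have key : ∀ s ∈ Finset.Ico e h, 2 * ∑ Q ∈ steppedDccp d d (n - h), (tipl (glue h s Q) : ℚ) =
      (h * (h + 1) * count d d (n - h) + 2 * total d d (n - h))
        + (1 + s : ℚ) * (2 * (((n - h : ℕ) : ℚ) * count d d (n - h))) := by
    intro s hs
    have : ∀ Q ∈ steppedDccp d d (n - h), 2 * (tipl (glue h s Q) : ℚ) =
        (h * (h + 1) + 2 * (1 + s) * ((n - h : ℕ) : ℚ)) + 2 * tipl Q := fun Q hQ => by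
      obtain ⟨hQ, -, hc⟩ := mem_steppedDccp.1 hQ
      have := tipl_glue (Finset.mem_Ico.1 hs).2 hQ
      rw [hc] at this
      have h' : (2 * (tipl (glue h s Q) : ℚ)) =
        h * (h + 1) + 2 * tipl Q + 2 * (1 + s) * ((n - h : ℕ) : ℚ) := by exact_mod_cast this
      rw [h']
      ring
    rw [Finset.mul_sum, Finset.sum_congr rfl this, Finset.sum_add_distrib, Finset.sum_const,
      ← Finset.mul_sum, nsmul_eq_mul, count, if_neg hnh, total]
    ring
  rw [Finset.mul_sum, Finset.sum_congr rfl key, Finset.sum_add_distrib, Finset.sum_const,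
    ← Finset.sum_mul, Nat.card_Ico, nsmul_eq_mul]
  ring

/-! ### Generating functions of the weights -/

/-- The power series `1 / (1 - x) ^ (k + 1)`. -/
noncomputable def geom (k : ℕ) : PowerSeries ℚ := PowerSeries.mk fun n => ((k + n).choose k : ℚ)

theorem geom_mul (k : ℕ) : geom k * (1 - PowerSeries.X) ^ (k + 1) = 1 :=
  PowerSeries.mk_add_choose_mul_one_sub_pow_eq_one ℚ k

theorem cast_choose_two (n : ℕ) : ((2 + n).choose 2 : ℚ) = (n + 1) * (n + 2) / 2 := by
  rw [Nat.cast_choose_two]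
  push_cast
  ring

theorem cast_choose_three (n : ℕ) :
    ((3 + n).choose 3 : ℚ) = (n + 1) * (n + 2) * (n + 3) / 6 := by
  induction n with
  | zero => norm_num
  | succ n ih =>
    rw [← add_assoc, Nat.choose_succ_succ', show 3 + n = 2 + (n + 1) by ring,
      Nat.cast_add, cast_choose_two, show 2 + (n + 1) = 3 + n by ring, ih]
    push_cast
    ring

theorem sum_Ico_one_add (e j : ℕ) :
    ∑ s ∈ Finset.Ico e (e + j), (1 + s : ℚ) = j * (1 + e) + j * (j - 1) / 2 := by
  induction j with
  | zero => simp
  | succ j ih =>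
    rw [← add_assoc, Finset.sum_Ico_succ_top (by omega), ih]
    push_cast
    ring

/-- Every weight in the recurrences vanishes up to an index `e`; beyond it, the weight is a
polynomial in `j`, read off in the binomial basis of the series `geom k`. -/
theorem mk_eq_X_pow_mul {a : ℕ → ℚ} {e : ℕ} {F : PowerSeries ℚ} (h0 : ∀ h ≤ e, a h = 0)
    (h1 : ∀ j, a (e + 1 + j) = PowerSeries.coeff j F) :
    PowerSeries.mk a = PowerSeries.X ^ (e + 1) * F := by
  ext n
  rw [PowerSeries.coeff_mk, PowerSeries.coeff_X_pow_mul']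
  split_ifs with h
  · obtain ⟨j, rfl⟩ := Nat.exists_eq_add_of_le h
    rw [h1, Nat.add_sub_cancel_left]
  · exact h0 n (by omega)

theorem mk_sub (e : ℕ) :
    PowerSeries.mk (fun h : ℕ => ((h - e : ℕ) : ℚ)) = PowerSeries.X ^ (e + 1) * geom 1 := by
  refine mk_eq_X_pow_mul (fun h hh => by simp [Nat.sub_eq_zero_of_le hh]) fun j => ?_
  rw [geom, PowerSeries.coeff_mk, show e + 1 + j - e = 1 + j by omega, Nat.choose_one_right]

theorem mk_sum_Ico (e : ℕ) :
    PowerSeries.mk (fun h : ℕ => ∑ s ∈ Finset.Ico e h, (1 + s : ℚ)) =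
      PowerSeries.X ^ (e + 1) * (PowerSeries.C (e : ℚ) * geom 1 + geom 2) := by
  refine mk_eq_X_pow_mul (fun h hh => by simp [Finset.Ico_eq_empty_of_le hh]) fun j => ?_
  rw [map_add, PowerSeries.coeff_C_mul, geom, geom, PowerSeries.coeff_mk, PowerSeries.coeff_mk,
    add_assoc, sum_Ico_one_add, Nat.choose_one_right, cast_choose_two]
  push_cast
  ring

/-- The constants expand `(j+1)(j+e+1)(j+e+2)` in the binomials `C(j+3,3)`, `C(j+2,2)`, `C(j+1,1)`.
-/
theorem mk_sub_mul (e : ℕ) :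
    PowerSeries.mk (fun h : ℕ => ((h - e : ℕ) : ℚ) * (h * (h + 1))) =
      PowerSeries.X ^ (e + 1) * (PowerSeries.C 6 * geom 3 + PowerSeries.C (4 * e - 4 : ℚ) * geom 2
        + PowerSeries.C (e ^ 2 - e : ℚ) * geom 1) := by
  refine mk_eq_X_pow_mul (fun h hh => by simp [Nat.sub_eq_zero_of_le hh]) fun j => ?_
  simp only [map_add, PowerSeries.coeff_C_mul, geom, PowerSeries.coeff_mk]
  rw [show e + 1 + j - e = 1 + j by omega, Nat.choose_one_right, cast_choose_two,
    cast_choose_three]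
  push_cast
  ring

theorem mk_mul_succ : PowerSeries.mk (fun n : ℕ => (n * (n + 1) : ℚ)) =
    PowerSeries.X ^ (0 + 1) * (PowerSeries.C 2 * geom 2) := by
  refine mk_eq_X_pow_mul (fun h hh => by simp [Nat.le_zero.1 hh]) fun j => ?_
  simp only [PowerSeries.coeff_C_mul, geom, PowerSeries.coeff_mk]
  rw [cast_choose_two]
  push_cast
  ring

theorem mk_ite : PowerSeries.mk (fun n : ℕ => (if n = 0 then 0 else 1 : ℚ)) =
    PowerSeries.X ^ (0 + 1) * geom 0 := by
  refine mk_eq_X_pow_mul (fun h hh => by simp [Nat.le_zero.1 hh]) fun j => ?_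
  simp [geom]

/-- The term `h = n` drops out because `b 0 = 0`; this is why `count` leaves out the empty
polyomino. -/
theorem coeff_mk_mul_mk {a b : ℕ → ℚ} (hb : b 0 = 0) (n : ℕ) :
    PowerSeries.coeff n (PowerSeries.mk a * PowerSeries.mk b) =
      ∑ h ∈ Finset.range n, a h * b (n - h) := by
  rw [PowerSeries.coeff_mul, Finset.Nat.sum_antidiagonal_eq_sum_range_succ_mk,
    Finset.sum_range_succ]
  simp [hb]

/-! ### Functional equations -/

theorem mk_count (e d : ℕ) : PowerSeries.mk (count e d) =
    PowerSeries.mk (fun n : ℕ => (if n = 0 then 0 else 1 : ℚ)) +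
      PowerSeries.mk (fun h : ℕ => ((h - e : ℕ) : ℚ)) * PowerSeries.mk (count d d) := by
  ext n
  rw [map_add, coeff_mk_mul_mk (by simp [count]), PowerSeries.coeff_mk, PowerSeries.coeff_mk]
  rcases Nat.eq_zero_or_pos n with rfl | hn
  · simp [count]
  · rw [count_eq hn, if_neg hn.ne']

theorem X_mul_derivative_mk (a : ℕ → ℚ) :
    PowerSeries.X * PowerSeries.derivative ℚ (PowerSeries.mk a) =
      PowerSeries.mk fun n : ℕ => (n : ℚ) * a n := by
  ext n
  cases n with
  | zero => simp
  | succ n =>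
    rw [PowerSeries.coeff_succ_X_mul, PowerSeries.coeff_derivative, PowerSeries.coeff_mk,
      PowerSeries.coeff_mk]
    push_cast
    ring

theorem mk_total (e d : ℕ) : 2 * PowerSeries.mk (total e d) =
    PowerSeries.mk (fun n : ℕ => (n * (n + 1) : ℚ)) +
      (PowerSeries.mk (fun h : ℕ => ((h - e : ℕ) : ℚ) * (h * (h + 1))) * PowerSeries.mk (count d d)
      + 2 * (PowerSeries.mk (fun h : ℕ => ((h - e : ℕ) : ℚ)) * PowerSeries.mk (total d d))
      + 2 * (PowerSeries.mk (fun h : ℕ => ∑ s ∈ Finset.Ico e h, (1 + s : ℚ)) *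
          (PowerSeries.X * PowerSeries.derivative ℚ (PowerSeries.mk (count d d))))) := by
  rw [X_mul_derivative_mk]
  ext n
  rw [← map_ofNat (PowerSeries.C (R := ℚ)) 2]
  simp only [map_add, PowerSeries.coeff_C_mul]
  rw [coeff_mk_mul_mk (by simp [count]), coeff_mk_mul_mk (total_zero d d),
    coeff_mk_mul_mk (by simp), PowerSeries.coeff_mk, PowerSeries.coeff_mk]
  rcases Nat.eq_zero_or_pos n with rfl | hn
  · simp [total_zero]
  · rw [total_eq hn, Finset.sum_add_distrib, Finset.sum_add_distrib, ← Finset.mul_sum,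
      ← Finset.mul_sum]

-- Solving the functional equations

local notation "𝐱" => (PowerSeries.X : PowerSeries ℚ)

theorem coe_ofNat (n : ℕ) [n.AtLeastTwo] :
    ((ofNat(n) : ℚ[X]) : PowerSeries ℚ) = ofNat(n) :=
  map_ofNat (Polynomial.coeToPowerSeries.ringHom (R := ℚ)) n

/-- The kernel `(1 - x) ^ 2 - x ^ (d + 1)` of the functional equations. -/
noncomputable def kernel (d : ℕ) : PowerSeries ℚ :=
  (1 - 𝐱) ^ 2 - 𝐱 ^ (d + 1)

/-- At `e = d` the counting equation involves a single unknown series. -/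
theorem kernel_mul_count (d : ℕ) : kernel d * PowerSeries.mk (count d d) =
    𝐱 * (1 - 𝐱) := by
  have h := mk_count d d
  rw [mk_ite, mk_sub] at h
  rw [kernel]
  linear_combination (1 - 𝐱) ^ 2 * h
    + 𝐱 * (1 - 𝐱) * geom_mul 0
    + 𝐱 ^ (d + 1) * PowerSeries.mk (count d d) * geom_mul 1

/-- Differentiate `K B = x(1-x)`, multiply by `x K`, and replace the remaining `K B`. -/
theorem kernel_sq_mul_derivative (d : ℕ) :
    kernel d ^ 2 * (𝐱 * PowerSeries.derivative ℚ (PowerSeries.mk (count d d))) =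
      kernel d * (𝐱 - 2 * 𝐱 ^ 2) +
        (2 * 𝐱 * (1 - 𝐱) + (d + 1) * 𝐱 ^ (d + 1)) *
          (𝐱 * (1 - 𝐱)) := by
  have h := kernel_mul_count d
  have h' := congrArg (PowerSeries.derivative ℚ) h
  have hk : PowerSeries.derivative ℚ (kernel d) =
      -2 * (1 - 𝐱) - (d + 1) * 𝐱 ^ d := by
    simp [kernel, Derivation.leibniz_pow]
    ring
  simp only [Derivation.leibniz, smul_eq_mul, hk, map_sub, PowerSeries.derivative_X,
    Derivation.map_one_eq_zero] at h'
  linear_combination 𝐱 * kernel d * h' +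
    (2 * 𝐱 * (1 - 𝐱) + (d + 1) * 𝐱 ^ (d + 1)) * h

/-- The factor `(1-x)^4` clears the worst denominator, that of `geom 3`. -/
theorem pow_mul_total (e d : ℕ) :
    2 * (1 - 𝐱) ^ 4 * PowerSeries.mk (total e d) =
      2 * 𝐱 * (1 - 𝐱)
      + 𝐱 ^ (e + 1) * ((6 + (4 * e - 4) * (1 - 𝐱)
          + (e ^ 2 - e) * (1 - 𝐱) ^ 2) * PowerSeries.mk (count d d)
        + 2 * (1 - 𝐱) ^ 2 * PowerSeries.mk (total d d)
        + 2 * (e * (1 - 𝐱) ^ 2 + (1 - 𝐱)) *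
          (𝐱 * PowerSeries.derivative ℚ (PowerSeries.mk (count d d)))) := by
  have h := mk_total e d
  rw [mk_mul_succ, mk_sub_mul, mk_sub, mk_sum_Ico] at h
  simp only [map_sub, map_mul, map_pow, map_natCast, map_ofNat] at h
  set u : PowerSeries ℚ := 1 - 𝐱 with hu
  set B := PowerSeries.mk (count d d)
  set D := 𝐱 * PowerSeries.derivative ℚ B
  have h1 : geom 1 * u ^ 4 = u ^ 2 := by linear_combination u ^ 2 * geom_mul 1
  have h2 : geom 2 * u ^ 4 = u := by linear_combination u * geom_mul 2
  have h3 : geom 3 * u ^ 4 = 1 := geom_mul 3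
  linear_combination u ^ 4 * h + 2 * 𝐱 * h2
    + 𝐱 ^ (e + 1) * (6 * B * h3 + (4 * e - 4) * B * h2 + (e ^ 2 - e) * B * h1
      + 2 * PowerSeries.mk (total d d) * h1 + 2 * e * D * h1 + 2 * D * h2)

theorem coe_g (d : ℕ) : (g d : PowerSeries ℚ) =
    -2 * (1 - 𝐱) ^ 3 * kernel d ^ 3 := by
  rw [g, kernel]
  push_cast
  simp only [coe_ofNat]
  ring

theorem isUnit_coe_g (d : ℕ) : IsUnit (g d : PowerSeries ℚ) := by
  rw [PowerSeries.isUnit_iff_constantCoeff, coe_g]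
  rw [map_mul, map_mul, map_neg, map_ofNat]
  simp [kernel]

theorem mk_total_mul_g (d : ℕ) :
    PowerSeries.mk (total 0 d) * (g d : PowerSeries ℚ) = (f d : PowerSeries ℚ) := by
  have hu : (1 - 𝐱 : PowerSeries ℚ) ≠ 0 := fun h => by
    simpa using congrArg PowerSeries.constantCoeff h
  have hB := kernel_mul_count d
  have hD := kernel_sq_mul_derivative d
  have hd := pow_mul_total d d
  have h0 := pow_mul_total 0 d
  -- The equation at `e = 0` carries `(1-x)^4`, whereas `g` carries only `(1-x)^3`.
  refine mul_left_cancel₀ hu ?_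
  rw [coe_g, f]
  push_cast
  simp only [coe_ofNat]
  simp only [map_sub, map_add, map_mul, map_pow, map_natCast, map_ofNat, map_one]
  set B := PowerSeries.mk (count d d)
  set D := 𝐱 * PowerSeries.derivative ℚ B
  set T := PowerSeries.mk (total d d)
  -- At `e = d` the terms in `T` collect into `2(1-x)^2 K T`; a further `K^2` clears the
  -- denominators of `B` and `D`.
  have hT : 2 * (1 - 𝐱) ^ 2 * kernel d ^ 3 * T =
      2 * 𝐱 * (1 - 𝐱) * kernel d ^ 2
      + 𝐱 ^ (d + 1) * ((6 + (4 * d - 4) * (1 - 𝐱)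
          + (d ^ 2 - d) * (1 - 𝐱) ^ 2) * kernel d *
            (𝐱 * (1 - 𝐱))
        + 2 * (d * (1 - 𝐱) ^ 2 + (1 - 𝐱)) *
          (kernel d * (𝐱 - 2 * 𝐱 ^ 2) +
          (2 * 𝐱 * (1 - 𝐱) + (d + 1) * 𝐱 ^ (d + 1)) *
          (𝐱 * (1 - 𝐱)))) := by
    have hk : kernel d = (1 - 𝐱) ^ 2 - 𝐱 ^ (d + 1) := rfl
    linear_combination kernel d ^ 2 * hd
      + 2 * (1 - 𝐱) ^ 2 * kernel d ^ 2 * T * hk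
      + 𝐱 ^ (d + 1) * ((6 + (4 * d - 4) * (1 - 𝐱)
          + (d ^ 2 - d) * (1 - 𝐱) ^ 2) * kernel d * hB
        + 2 * (d * (1 - 𝐱) ^ 2 + (1 - 𝐱)) * hD)
  -- At `e = 0`, multiplied by `K^3`, each of `B`, `D` and `T` is replaced by its solution.
  have key : 2 * (1 - 𝐱) ^ 4 * kernel d ^ 3 * PowerSeries.mk (total 0 d) =
      2 * 𝐱 * (1 - 𝐱) * kernel d ^ 3
      + 𝐱 * ((6 - 4 * (1 - 𝐱)) * kernel d ^ 2 *
          (𝐱 * (1 - 𝐱))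
        + (2 * 𝐱 * (1 - 𝐱) * kernel d ^ 2
          + 𝐱 ^ (d + 1) * ((6 + (4 * d - 4) * (1 - 𝐱)
          + (d ^ 2 - d) * (1 - 𝐱) ^ 2) * kernel d *
            (𝐱 * (1 - 𝐱))
        + 2 * (d * (1 - 𝐱) ^ 2 + (1 - 𝐱)) *
          (kernel d * (𝐱 - 2 * 𝐱 ^ 2) +
          (2 * 𝐱 * (1 - 𝐱) + (d + 1) * 𝐱 ^ (d + 1)) *
          (𝐱 * (1 - 𝐱)))))
        + 2 * (1 - 𝐱) * kernel d *
          (kernel d * (𝐱 - 2 * 𝐱 ^ 2) +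
          (2 * 𝐱 * (1 - 𝐱) + (d + 1) * 𝐱 ^ (d + 1)) *
          (𝐱 * (1 - 𝐱)))) := by
    push_cast at h0
    linear_combination kernel d ^ 3 * h0
      + 𝐱 * ((6 - 4 * (1 - 𝐱)) * kernel d ^ 2 * hB
        + hT + 2 * (1 - 𝐱) * kernel d * hD)
  rw [kernel] at key ⊢
  linear_combination -key

end Dccp

theorem mainTheorem2 (d : ℕ) :
    IsUnit (Dccp.g d : PowerSeries ℚ) ∧
      PowerSeries.mk (fun n : ℕ => (Dccp.t d n : ℚ)) =
        (Dccp.f d : PowerSeries ℚ) * (Dccp.g d : PowerSeries ℚ)⁻¹ := by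
  have hg := Dccp.isUnit_coe_g d
  refine ⟨hg, ?_⟩
  rw [PowerSeries.eq_mul_inv_iff_mul_eq
    (PowerSeries.isUnit_iff_constantCoeff.1 hg).ne_zero, ← Dccp.mk_total_mul_g]
  congr 2
  funext n
  rw [Dccp.t_eq_sum, Dccp.total, Nat.cast_sum]
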